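/- Let $\mathcal L_n$ be the face poset of the $n$-cube, realised as the closed intervals $[p,q]$, $p\subseteq q$, of the power set of an $n$-element set, ordered by inclusion; write $\mathbf 1$ for its top element and $\vee$ for its join. For $y\le x$ let $\Delta(x,y)$ be the reflection of the face $y$ through the centre of the face $x$, i.e. $\Delta([p,q],[s,u])=[p\cup(q\setminus u),\,p\cup(q\setminus s)]$, and for all $x,y$ let the caret of $x$ and $y$ be the meet $x\wedge\Delta(x\vee y,y)$ whenever this meet exists. An MR-subalgebra of $\mathcal L_n$ is a subset containing $\mathbf 1$ and closed under $\vee$, $\Delta$ and the caret. $\mathrm{Aut}(\mathcal L_n)$ is the group of bijections of $\mathcal L_n$ that preserve $\vee$ and $\Delta$; it acts on MR-subalgebras by $\phi\cdot A=\phi[A]$, with $\mathrm{Stab}(A)=\{\phi : \phi[A]=A\}$ and $\mathrm{Orb}(A)=\{\phi[A] : \phi\in\mathrm{Aut}(\mathcal L_n)\}$. Let $A$ be an MR-subalgebra of $\mathcal L_n$. Its coatoms are the maximal elements of $A\setminus\{\mathbf 1\}$. For every $i$, the number of coatoms $a$ of $A$ such that exactly $i$ coatoms of $\mathcal L_n$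 lie above $a$ (that is, are $\ge a$) is even; write it as $2t_i$. The type of $A$ is the sequence $\langle t_i\mid 1\le i\le n\rangle$. Let $r=\sum_{i=1}^n i\,t_i$ and $k=\sum_{i=1}^n t_i$. Then $k\le r\le n$, $$|\mathrm{Orb}(A)| = \frac{2^{r-k}\binom nr\, r!}{\prod_{i=1}^n (i!)^{t_i}\,t_i!},$$ and $$|\mathrm{Stab}(A)| = 2^{n+k-r}\,(n-r)!\,\prod_{i=1}^n (i!)^{t_i}\,t_i!.$$ -/

import Mathlib

/-- The face poset `L_n` of the `n`-cube. The vertices of the cube are the subsets of an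
`n`-element set and its (nonempty) faces are the closed intervals `[p, q]` with `p ⊆ q`,
ordered by inclusion; the top element is the whole cube. -/
abbrev CubeFace (n : ℕ) : Type := NonemptyInterval (Finset (Fin n))

namespace CubeFace

variable {n : ℕ}

/-- `delta x y` is the reflection of the face `y` through the centre of the face `x`, for `y ≤ x`.
The reflection of a vertex `v` of `x = [p, q]` is `p ∪ (q \ v)`, so `y = [s, t]` is sent to
`[p ∪ (q \ t), p ∪ (q \ s)]`. The value is used only for `y ≤ x`. -/
def delta (x y : CubeFace n) : CubeFace n where
  fst := x.fst ∪ (x.snd \ y.snd)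
  snd := x.fst ∪ (x.snd \ y.fst)
  fst_le_snd :=
    Finset.union_subset_union_right (Finset.sdiff_subset_sdiff (Finset.Subset.refl _) y.fst_le_snd)

/-- `IsCaret x y z` says that `z` is the caret of `x` and `y`, that is, the meet of `x` and
`delta (x ⊔ y) y`. -/
def IsCaret (x y z : CubeFace n) : Prop := IsGLB {x, delta (x ⊔ y) y} z

end CubeFace

/-- The group of automorphisms of `L_n`: the bijections preserving the join and
the (partial) operation `delta`. -/
def CubeAut (n : ℕ) : Subgroup (Equiv.Perm (CubeFace n)) where
  carrier := {φ | (∀ x y, φ (x ⊔ y) = φ x ⊔ φ y) ∧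
    ∀ x y, y ≤ x → φ (CubeFace.delta x y) = CubeFace.delta (φ x) (φ y)}
  one_mem' := ⟨fun _ _ => rfl, fun _ _ _ => rfl⟩
  mul_mem' := by
    rintro φ ψ ⟨h1, h2⟩ ⟨h3, h4⟩
    refine ⟨fun x y => by simp [h1, h3], fun x y hxy => ?_⟩
    have : ψ y ≤ ψ x := by rw [← sup_eq_right, ← h3, sup_eq_right.2 hxy]
    simp [h4 x y hxy, h2 _ _ this]
  inv_mem' := by
    rintro φ ⟨h1, h2⟩
    have hs : ∀ x y, φ⁻¹ (x ⊔ y) = φ⁻¹ x ⊔ φ⁻¹ y := fun x y => by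
      apply φ.injective; simp [h1]
    refine ⟨hs, fun x y hxy => ?_⟩
    have : φ⁻¹ y ≤ φ⁻¹ x := by rw [← sup_eq_right, ← hs, sup_eq_right.2 hxy]
    apply φ.injective
    rw [h2 _ _ this]
    simp

theorem CubeAut.le_iff {n : ℕ} (φ : CubeAut n) (x y : CubeFace n) :
    φ.1 x ≤ φ.1 y ↔ x ≤ y := by
  rw [← sup_eq_right, ← φ.2.1, φ.1.injective.eq_iff, sup_eq_right]

theorem CubeAut.isCaret_iff {n : ℕ} (φ : CubeAut n) (x y z : CubeFace n) :
    CubeFace.IsCaret (φ.1 x) (φ.1 y) (φ.1 z) ↔ CubeFace.IsCaret x y z := by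
  have h : CubeFace.delta (φ.1 x ⊔ φ.1 y) (φ.1 y) = φ.1 (CubeFace.delta (x ⊔ y) y) := by
    rw [φ.2.2 _ _ le_sup_right, φ.2.1]
  unfold CubeFace.IsCaret
  rw [h]
  let e : CubeFace n ≃o CubeFace n := ⟨φ.1, fun {a b} => CubeAut.le_iff φ a b⟩
  have := e.isGLB_image' (s := {x, CubeFace.delta (x ⊔ y) y}) (x := z)
  rwa [Set.image_pair] at this

/-- An MR-subalgebra of `L_n`: a set of faces that contains the top element and is closed under
the join, under `delta` and under the caret operation. -/
@[ext]
structure MRSubalgebra (n : ℕ) where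
  carrier : Set (CubeFace n)
  top_mem : ⊤ ∈ carrier
  sup_mem : ∀ x ∈ carrier, ∀ y ∈ carrier, x ⊔ y ∈ carrier
  delta_mem : ∀ x ∈ carrier, ∀ y ∈ carrier, y ≤ x → CubeFace.delta x y ∈ carrier
  caret_mem : ∀ x ∈ carrier, ∀ y ∈ carrier, ∀ z, CubeFace.IsCaret x y z → z ∈ carrier

/-- The evaluation action: `φ • A` is the image of `A` under `φ`. -/
instance (n : ℕ) : MulAction (CubeAut n) (MRSubalgebra n) where
  smul φ A :=
    { carrier := φ.1 '' A.carrier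
      top_mem := ⟨⊤, A.top_mem, by
        apply top_unique
        have := (CubeAut.le_iff φ (φ.1⁻¹ ⊤) ⊤).2 le_top
        simpa using this⟩
      sup_mem := by
        rintro _ ⟨x, hx, rfl⟩ _ ⟨y, hy, rfl⟩
        exact ⟨x ⊔ y, A.sup_mem x hx y hy, φ.2.1 x y⟩
      delta_mem := by
        rintro _ ⟨x, hx, rfl⟩ _ ⟨y, hy, rfl⟩ h
        rw [CubeAut.le_iff] at h
        exact ⟨_, A.delta_mem x hx y hy h, φ.2.2 x y h⟩
      caret_mem := by
        rintro _ ⟨x, hx, rfl⟩ _ ⟨y, hy, rfl⟩ z hz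
        obtain ⟨w, rfl⟩ := φ.1.surjective z
        exact ⟨w, A.caret_mem x hx y hy w ((CubeAut.isCaret_iff φ x y w).1 hz), rfl⟩ }
  one_smul A := MRSubalgebra.ext (Set.image_id A.carrier)
  mul_smul φ ψ A := MRSubalgebra.ext (Set.image_comp φ.1 ψ.1 A.carrier)

namespace MRSubalgebra

variable {n : ℕ}

/-- The coatoms of `A`: the maximal elements of `A` other than the top element. -/
def coatoms (A : MRSubalgebra n) : Set (CubeFace n) :=
  {a | a ∈ A.carrier ∧ a ≠ ⊤ ∧ ∀ b ∈ A.carrier, a < b → b = ⊤}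

/-- The set of coatoms of `L_n` that lie above `a`. -/
def coatomsAbove (a : CubeFace n) : Set (CubeFace n) := {c | IsCoatom c ∧ a ≤ c}

/-- The number of coatoms of `A` below exactly `i` coatoms of `L_n`. -/
noncomputable def coatomCount (A : MRSubalgebra n) (i : ℕ) : ℕ :=
  {a | a ∈ A.coatoms ∧ (coatomsAbove a).ncard = i}.ncard

/-- The type `⟨t_i⟩` of `A`: `2 * t_i` is the number of coatoms of `A` below exactly `i` coatoms of
`L_n`, this number being even. -/
noncomputable def tp (A : MRSubalgebra n) (i : ℕ) : ℕ := A.coatomCount i / 2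

end MRSubalgebra

/-!
A face of the `n`-cube is encoded by a sign vector `Fin n → SignType`, the coordinate `0` marking a
direction in which the face extends; facets are the vectors with one nonzero coordinate. In these
terms `⊔` keeps the coordinates on which two vectors agree, `delta x y` is the composition
`x ∘ (-y)` (`x` where it is nonzero, `-y` elsewhere), and the caret of `x` and `y` always exists and
is again `x ∘ (-y)` (`CubeFace.isCaret_ofCoord`). So an MR-subalgebra `A` is a set of sign vectors
that contains `0` and is closed under negation, composition and agreement.

Such sets have a rigid structure. Call two coordinates at which `A` does not vanish identically
linked if they are equal, or opposite, throughout `A`. Among the `x` in `A` with `x i = 1` there is a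
greatest one, and its support is exactly the class of coordinates linked to `i`
(`MRSubalgebra.coord_eq_mul_of_greatest`). Composing these elements and their negatives yields every
vector that respects the links, so that `A` is described by disjoint blocks of coordinates and a
sign `σ i` for each coordinate `i`: its elements are the vectors that vanish outside the blocks and
are, up to `σ`, constant on each block (`MRSubalgebra.exists_isBlockDecomposition`). The coatoms
are the pairs of opposite vectors `± σ` on a single block, whence `t i` is the number of blocks of
size `i`, `r` the number of coordinates lying in a block, and `k` the number of blocks.

An automorphism permutes the facets and commutes with their antipodal map, so the automorphism group
is the group of signed permutations, of order `2 ^ n * n!` (`CubeAut.exists_eq_signedPerm`). Those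
stabilizing `A` are the ones that permute the blocks and whose signs, measured against `σ`, are
constant on each block (`signedPerm_mem_stabilizer_iff`). The signs contribute `2 ^ (k + (n - r))`;
the permutations contribute `(n - r)!` outside the blocks, `∏ (t i)!` for permuting blocks of equal
size, and `∏ (i !) ^ t i` inside the blocks. The orbit is counted by the orbit-stabilizer theorem.
-/

/-! ### Faces as sign vectors -/

namespace CubeFace

variable {n : ℕ}

/-- The sign vector of a face: the coordinate at `i` is `1` or `-1` if all vertices of the face
contain `i` or if none does, and `0` if the face extends in the direction `i`. -/
def coord (x : CubeFace n) (i : Fin n) : SignType :=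
  if i ∈ x.fst then 1 else if i ∈ x.snd then 0 else -1

/-- The face with a given sign vector. -/
def ofCoord (f : Fin n → SignType) : CubeFace n where
  fst := {i | f i = 1}
  snd := {i | f i ≠ -1}
  fst_le_snd := by
    intro i hi
    simp only [Finset.mem_filter, Finset.mem_univ, true_and] at hi ⊢
    simp [hi]

@[simp]
theorem coord_ofCoord (f : Fin n → SignType) (i : Fin n) : (ofCoord f).coord i = f i := by
  simp only [coord, ofCoord, Finset.mem_filter, Finset.mem_univ, true_and]
  generalize f i = s
  revert s; decide

theorem mem_fst_iff (x : CubeFace n) (i : Fin n) : i ∈ x.fst ↔ x.coord i = 1 := by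
  unfold coord
  split_ifs <;> simp_all

theorem mem_snd_iff (x : CubeFace n) (i : Fin n) : i ∈ x.snd ↔ x.coord i ≠ -1 := by
  have := @x.fst_le_snd i
  unfold coord
  split_ifs <;> simp_all

theorem coord_ext {x y : CubeFace n} (h : ∀ i, x.coord i = y.coord i) : x = y := by
  apply NonemptyInterval.ext
  apply Prod.ext
  · ext i; simp [mem_fst_iff, h]
  · ext i; simp [mem_snd_iff, h]

theorem le_iff_coord {x y : CubeFace n} :
    x ≤ y ↔ ∀ i, y.coord i ≠ 0 → x.coord i = y.coord i := by
  rw [NonemptyInterval.le_def, Finset.subset_iff,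
    Finset.subset_iff, ← forall_and]
  refine forall_congr' fun i => ?_
  rw [mem_fst_iff, mem_fst_iff, mem_snd_iff, mem_snd_iff]
  generalize x.coord i = s
  generalize y.coord i = t
  revert s t; decide

@[simp]
theorem coord_top (i : Fin n) : (⊤ : CubeFace n).coord i = 0 := by
  have h : (⊤ : CubeFace n) = ofCoord fun _ => 0 :=
    (top_unique (le_iff_coord.2 (by simp))).symm
  rw [h, coord_ofCoord]

theorem coord_sup (x y : CubeFace n) (i : Fin n) :
    (x ⊔ y).coord i = if x.coord i = y.coord i then x.coord i else 0 := by
  have h : i ∈ (x ⊔ y).fst ↔ x.coord i = 1 ∧ y.coord i = 1 := by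
    simp [mem_fst_iff]
  have h' : i ∈ (x ⊔ y).snd ↔ x.coord i ≠ -1 ∨ y.coord i ≠ -1 := by
    simp [mem_snd_iff]
  rw [coord.eq_def (x ⊔ y)]
  simp only [h, h']
  generalize x.coord i = s
  generalize y.coord i = t
  revert s t; decide

theorem coord_delta (x y : CubeFace n) (i : Fin n) :
    (delta x y).coord i = if x.coord i = 0 then -y.coord i else x.coord i := by
  have h : i ∈ (delta x y).fst ↔ x.coord i = 1 ∨ (x.coord i ≠ -1 ∧ ¬ y.coord i ≠ -1) := by
    simp only [delta, Finset.mem_union, Finset.mem_sdiff, mem_fst_iff, mem_snd_iff]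
  have h' : i ∈ (delta x y).snd ↔ x.coord i = 1 ∨ (x.coord i ≠ -1 ∧ ¬ y.coord i = 1) := by
    simp only [delta, Finset.mem_union, Finset.mem_sdiff, mem_fst_iff, mem_snd_iff]
  rw [coord.eq_def (delta x y)]
  simp only [h, h']
  generalize x.coord i = s
  generalize y.coord i = t
  revert s t; decide

theorem ne_top_iff {x : CubeFace n} : x ≠ ⊤ ↔ ∃ i, x.coord i ≠ 0 := by
  rw [ne_eq, ← not_forall_not, not_iff_not]
  refine ⟨fun h => by simp [h], fun h => coord_ext fun i => ?_⟩
  have := h i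
  simp_all

/-- Since `delta (x ⊔ y) y` carries the sign of `x` wherever both `x` and `y` have a nonzero
coordinate, the meet defining the caret always exists: it is the composition `x ∘ (-y)` of sign
vectors. -/
theorem isCaret_ofCoord (x y : CubeFace n) :
    IsCaret x y (ofCoord fun i => if x.coord i = 0 then -y.coord i else x.coord i) := by
  constructor
  · rintro z (rfl | rfl) <;> rw [le_iff_coord] <;> intro i
    · simp +contextual
    · simp only [coord_delta, coord_sup, coord_ofCoord]
      generalize x.coord i = s
      generalize y.coord i = t
      revert s t; decide
  · intro z hz
    have hx := le_iff_coord.1 (hz (Set.mem_insert _ _))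
    have hy := le_iff_coord.1 (hz (Set.mem_insert_of_mem _ rfl))
    rw [le_iff_coord]
    intro i
    have hx := hx i
    have hy := hy i
    simp only [coord_delta, coord_sup, coord_ofCoord] at hx hy ⊢
    generalize x.coord i = s at *
    generalize y.coord i = t at *
    generalize z.coord i = u at *
    revert s t u; decide

/-- The facet of the cube on which the coordinate `i` has the sign `s`. -/
def facet (i : Fin n) (s : SignTypeˣ) : CubeFace n := ofCoord (Pi.single i (s : SignType))

theorem le_facet_iff {x : CubeFace n} {i : Fin n} {s : SignTypeˣ} :
    x ≤ facet i s ↔ x.coord i = s := by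
  rw [le_iff_coord]
  constructor
  · intro h
    have := h i
    simpa [facet] using this
  · intro h j hj
    rcases eq_or_ne j i with rfl | hji
    · simp [facet, h]
    · simp [facet, hji] at hj

theorem isCoatom_facet (i : Fin n) (s : SignTypeˣ) : IsCoatom (facet i s) := by
  refine ⟨ne_top_iff.2 ⟨i, by simp [facet]⟩, fun b hb => ?_⟩
  by_contra hbt
  obtain ⟨j, hj⟩ := ne_top_iff.1 hbt
  have h1 := le_iff_coord.1 hb.le j hj
  have hji : j = i := by
    by_contra hji
    simp [facet, hji] at h1
    exact hj h1.symm
  subst hji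
  exact hb.not_ge (le_facet_iff.2 (by rw [← h1]; simp [facet]))

theorem isCoatom_iff {c : CubeFace n} : IsCoatom c ↔ ∃ i s, c = facet i s := by
  constructor
  · intro h
    obtain ⟨i, hi⟩ := ne_top_iff.1 h.1
    refine ⟨i, Units.mk0 _ hi, ?_⟩
    rcases (le_facet_iff (s := Units.mk0 _ hi).2 rfl : c ≤ _).eq_or_lt with h' | h'
    · exact h'
    · exact absurd (h.2 _ h') (isCoatom_facet _ _).1
  · rintro ⟨i, s, rfl⟩
    exact isCoatom_facet i s

theorem facet_inj {i j : Fin n} {s u : SignTypeˣ} : facet i s = facet j u ↔ i = j ∧ s = u := by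
  refine ⟨fun h => ?_, fun h => by rw [h.1, h.2]⟩
  have h1 : (facet i s).coord j = u := le_facet_iff.1 h.le
  rcases eq_or_ne j i with rfl | hji
  · simp only [facet, coord_ofCoord, Pi.single_eq_same] at h1
    exact ⟨rfl, Units.ext h1⟩
  · simp only [facet, coord_ofCoord, Pi.single_eq_of_ne hji] at h1
    exact absurd h1.symm u.ne_zero

theorem delta_top_facet (i : Fin n) (s : SignTypeˣ) : delta ⊤ (facet i s) = facet i (-s) := by
  refine coord_ext fun j => ?_
  rw [coord_delta]
  rcases eq_or_ne j i with rfl | hji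
  · simp [facet]
  · simp [facet, hji]

end CubeFace

namespace SignType

theorem unit_mul_self (u : SignTypeˣ) : (u : SignType) * u = 1 := by
  revert u; decide

theorem unit_eq_or_eq_neg (u v : SignTypeˣ) : v = u ∨ v = -u := by
  revert u v; decide

theorem card_units : Fintype.card SignTypeˣ = 2 := by decide

end SignType

open CubeFace

namespace MRSubalgebra

variable {n : ℕ} (A : MRSubalgebra n)

theorem ncard_coatomsAbove (a : CubeFace n) :
    (coatomsAbove a).ncard = {i | a.coord i ≠ 0}.ncard := by
  symm
  refine Set.ncard_congr (fun i hi => facet i (Units.mk0 (a.coord i) hi)) ?_ ?_ ?_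
  · intro i hi
    exact ⟨isCoatom_facet _ _, le_facet_iff.2 rfl⟩
  · intro i j hi hj h
    exact (facet_inj.1 h).1
  · rintro c ⟨hc, hac⟩
    obtain ⟨i, s, rfl⟩ := isCoatom_iff.1 hc
    rw [le_facet_iff] at hac
    refine ⟨i, by simp [hac], ?_⟩
    congr 1
    exact Units.ext hac

variable {A}

theorem neg_mem {x : CubeFace n} (hx : x ∈ A.carrier) :
    ofCoord (fun i => -x.coord i) ∈ A.carrier := by
  have h := A.delta_mem ⊤ A.top_mem x hx le_top
  convert h
  refine coord_ext fun i => ?_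
  simp [coord_delta]

/-- Composition of sign vectors is the caret of the first with the negative of the second. -/
theorem comp_mem {x y : CubeFace n} (hx : x ∈ A.carrier) (hy : y ∈ A.carrier) :
    ofCoord (fun i => if x.coord i = 0 then y.coord i else x.coord i) ∈ A.carrier := by
  have h := A.caret_mem x hx _ (neg_mem hy) _ (isCaret_ofCoord _ _)
  simpa using h

end MRSubalgebra

/-! ### Block decompositions -/

theorem CubeFace.finite_cubeFace (n : ℕ) : Finite (CubeFace n) :=
  Finite.of_injective (fun x => x.toProd) NonemptyInterval.toProd_injective

namespace MRSubalgebra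

variable {n : ℕ} {A : MRSubalgebra n}

theorem exists_greatest {i : Fin n} (hi : ∃ x ∈ A.carrier, x.coord i ≠ 0) :
    ∃ m ∈ A.carrier, m.coord i = 1 ∧ ∀ x ∈ A.carrier, x.coord i = 1 → x ≤ m := by
  have := finite_cubeFace n
  have hne : {x | x ∈ A.carrier ∧ x.coord i = 1}.Nonempty := by
    obtain ⟨x, hx, hxi⟩ := hi
    rcases SignType.trichotomy (x.coord i) with h | h | h
    · exact ⟨_, neg_mem hx, by simp [h]⟩
    · exact absurd h hxi
    · exact ⟨x, hx, h⟩
  obtain ⟨m, hm⟩ := (Set.toFinite {x | x ∈ A.carrier ∧ x.coord i = 1}).exists_maximal hne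
  refine ⟨m, hm.prop.1, hm.prop.2, fun x hx hxi => ?_⟩
  have h : x ⊔ m ∈ {x | x ∈ A.carrier ∧ x.coord i = 1} :=
    ⟨A.sup_mem x hx m hm.prop.1, by rw [coord_sup, hxi, hm.prop.2]; rfl⟩
  exact le_sup_left.trans (hm.le_of_ge h le_sup_right)

/-- The coordinates on which the greatest element `m` with `m i = 1` is nonzero are linked to the
coordinate `i` throughout `A`. If some `x` vanished at `i` but not at `i'`, then the composition
of `x` or `-x` with `m` would have the coordinate `1` at `i` without lying below `m`. -/
theorem coord_eq_mul_of_greatest {i : Fin n} {m : CubeFace n} (hm : m ∈ A.carrier)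
    (hmi : m.coord i = 1) (hmax : ∀ x ∈ A.carrier, x.coord i = 1 → x ≤ m) {i' : Fin n}
    (hi' : m.coord i' ≠ 0) {x : CubeFace n} (hx : x ∈ A.carrier) :
    x.coord i' = m.coord i' * x.coord i := by
  have key : ∀ y ∈ A.carrier, y.coord i = 1 → y.coord i' = m.coord i' := fun y hy hyi =>
    le_iff_coord.1 (hmax y hy hyi) i' hi'
  have h1 := key x hx
  have h2 := key _ (neg_mem hx)
  have h3 := key _ (comp_mem hx hm)
  have h4 := key _ (comp_mem (neg_mem hx) hm)
  simp only [coord_ofCoord, hmi] at h1 h2 h3 h4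
  clear key
  generalize x.coord i = s at *
  generalize x.coord i' = t at *
  generalize m.coord i' = u at *
  revert s t u; decide

/-- A description of an MR-subalgebra by blocks. The map `g` sends a coordinate to its block, and
to `none` if all elements of `A` vanish at it; every `j : J` is the name of a (nonempty) block. Up
to the signs `σ`, the elements of `A` are exactly the sign vectors that vanish outside the blocks
and are constant on each block. -/
structure IsBlockDecomposition (A : MRSubalgebra n) {J : Type} (g : Fin n → Option J)
    (σ : Fin n → SignTypeˣ) : Prop where
  exists_eq_some : ∀ j, ∃ i, g i = some j
  mem_iff : ∀ x, x ∈ A.carrier ↔ (∀ i, g i = none → x.coord i = 0) ∧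
    ∀ i i', g i = g i' → (σ i : SignType) * x.coord i = σ i' * x.coord i'

variable (A) in
/-- Two coordinates at which `A` does not vanish identically are linked if they agree, or are
opposite, throughout `A`. -/
def linkSetoid : Setoid {i : Fin n // ∃ x ∈ A.carrier, x.coord i ≠ 0} where
  r i i' := ∃ u : SignTypeˣ, ∀ x ∈ A.carrier, x.coord i' = u * x.coord i
  iseqv :=
    { refl := fun i => ⟨1, by simp⟩
      symm := by
        rintro i i' ⟨u, h⟩
        exact ⟨u, fun x hx => by rw [h x hx, ← mul_assoc, SignType.unit_mul_self, one_mul]⟩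
      trans := by
        rintro i i' i'' ⟨u, h⟩ ⟨v, h'⟩
        exact ⟨v * u, fun x hx => by rw [h' x hx, h x hx, Units.val_mul, mul_assoc]⟩ }

/-- A vector `x` that respects all links and all common zeros of `A` belongs to `A`. For each `i`
with `x i ≠ 0` the greatest element of `A` with coordinate `x i` at `i` lies above `x`, and `x` is
the composition of these elements. -/
theorem mem_of_forall_linked {x : CubeFace n}
    (hnull : ∀ i, (∀ y ∈ A.carrier, y.coord i = 0) → x.coord i = 0)
    (hlink : ∀ i i', ∀ u : SignTypeˣ, (∀ y ∈ A.carrier, y.coord i' = u * y.coord i) →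
      x.coord i' = u * x.coord i) : x ∈ A.carrier := by
  have key : ∀ S : Finset (Fin n), ∃ y ∈ A.carrier, x ≤ y ∧
      ∀ i ∈ S, x.coord i ≠ 0 → y.coord i ≠ 0 := by
    intro S
    induction S using Finset.induction_on with
    | empty => exact ⟨⊤, A.top_mem, le_top, by simp⟩
    | insert i S _ ih =>
      obtain ⟨y, hy, hxy, hS⟩ := ih
      rcases eq_or_ne (x.coord i) 0 with hxi | hxi
      · refine ⟨y, hy, hxy, fun j hj hxj => ?_⟩
        rcases Finset.mem_insert.1 hj with rfl | hj
        · exact absurd hxi hxj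
        · exact hS j hj hxj
      have hi : ∃ z ∈ A.carrier, z.coord i ≠ 0 := by
        by_contra! h
        exact hxi (hnull i h)
      obtain ⟨m, hm, hmi, hmax⟩ := exists_greatest hi
      have hm' : ofCoord (fun i' => x.coord i * m.coord i') ∈ A.carrier := by
        rcases SignType.trichotomy (x.coord i) with h | h | h
        · simpa [h] using neg_mem hm
        · exact absurd h hxi
        · convert hm
          exact coord_ext fun i' => by simp [h]
      -- `x` agrees with `x i * m` on the support of `m`, so composing `y` with that stays above `x`.
      refine ⟨_, comp_mem hy hm', ?_, ?_⟩
      · rw [le_iff_coord] at hxy ⊢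
        intro i' hi'
        simp only [coord_ofCoord] at hi' ⊢
        split_ifs at hi' ⊢ with h0
        · have hmi' : m.coord i' ≠ 0 := right_ne_zero_of_mul hi'
          rw [hlink i i' (Units.mk0 _ hmi')
            (fun z hz => coord_eq_mul_of_greatest hm hmi hmax hmi' hz), Units.val_mk0, mul_comm]
        · exact hxy i' hi'
      · intro j hj hxj
        simp only [coord_ofCoord]
        split_ifs with h0
        · rcases Finset.mem_insert.1 hj with rfl | hj
          · simpa [hmi] using hxi
          · exact absurd h0 (hS j hj hxj)
        · exact h0
  obtain ⟨y, hy, hxy, hS⟩ := key Finset.univ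
  convert hy
  refine coord_ext fun i => ?_
  by_contra h
  have h1 := mt (le_iff_coord.1 hxy i) h
  have h2 := hS i (Finset.mem_univ i)
  rw [not_not] at h1
  rw [h1] at h
  exact h2 h h1

variable (A) in
/-- The blocks are the classes of linked coordinates; `σ` compares each coordinate with a chosen
representative of its class. -/
theorem exists_isBlockDecomposition :
    ∃ (J : Type) (_ : Fintype J) (g : Fin n → Option J) (σ : Fin n → SignTypeˣ),
      A.IsBlockDecomposition g σ := by
  classical
  let _ := A.linkSetoid
  have hout : ∀ i, ∃ u : SignTypeˣ, ∀ x ∈ A.carrier,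
      x.coord i.1 = u * x.coord (⟦i⟧ : Quotient A.linkSetoid).out.1 :=
    fun i => Quotient.mk_out i
  choose τ hτ using hout
  let g : Fin n → Option (Quotient A.linkSetoid) := fun i =>
    if h : ∃ x ∈ A.carrier, x.coord i ≠ 0 then some ⟦⟨i, h⟩⟧ else none
  let σ : Fin n → SignTypeˣ := fun i =>
    if h : ∃ x ∈ A.carrier, x.coord i ≠ 0 then τ ⟨i, h⟩ else 1
  have hg : ∀ i, g i = none → ∀ x ∈ A.carrier, x.coord i = 0 := by
    intro i hi x hx
    by_contra h
    have : ∃ x ∈ A.carrier, x.coord i ≠ 0 := ⟨x, hx, h⟩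
    simp only [g, dif_pos this] at hi
    cases hi
  have hσ : ∀ i (h : ∃ x ∈ A.carrier, x.coord i ≠ 0), ∀ x ∈ A.carrier,
      (σ i : SignType) * x.coord i = x.coord (⟦⟨i, h⟩⟧ : Quotient A.linkSetoid).out.1 := by
    intro i h x hx
    have := hτ ⟨i, h⟩ x hx
    simp only [σ, dif_pos h]
    rw [this, ← mul_assoc, SignType.unit_mul_self, one_mul]
  have hfwd : ∀ x ∈ A.carrier, ∀ i i', g i = g i' →
      (σ i : SignType) * x.coord i = σ i' * x.coord i' := by
    intro x hx i i' h
    by_cases hi : ∃ x ∈ A.carrier, x.coord i ≠ 0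
    · by_cases hi' : ∃ x ∈ A.carrier, x.coord i' ≠ 0
      · simp only [g, dif_pos hi, dif_pos hi', Option.some.injEq] at h
        rw [hσ i hi x hx, hσ i' hi' x hx, h]
      · simp only [g, dif_pos hi, dif_neg hi'] at h
        cases h
    · have h0 : g i = none := dif_neg hi
      rw [hg i h0 x hx, hg i' (h ▸ h0) x hx, mul_zero, mul_zero]
  refine ⟨Quotient A.linkSetoid, Fintype.ofFinite _, g, σ, ?_, fun x => ⟨fun hx => ?_, ?_⟩⟩
  · intro j
    obtain ⟨i, rfl⟩ := Quotient.exists_rep j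
    exact ⟨i.1, dif_pos i.2⟩
  · exact ⟨fun i hi => hg i hi x hx, hfwd x hx⟩
  · rintro ⟨h1, h2⟩
    refine mem_of_forall_linked (fun i hi => h1 i (dif_neg ?_)) fun i i' u hu => ?_
    · push Not
      exact hi
    by_cases hi : ∃ y ∈ A.carrier, y.coord i ≠ 0
    · have hi' : ∃ y ∈ A.carrier, y.coord i' ≠ 0 := by
        obtain ⟨y, hy, hyi⟩ := hi
        exact ⟨y, hy, by rw [hu y hy]; exact mul_ne_zero u.ne_zero hyi⟩
      have hgg : g i = g i' := by
        simp only [g, dif_pos hi, dif_pos hi', Option.some.injEq]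
        exact Quotient.sound ⟨u, hu⟩
      obtain ⟨y, hy, hyi⟩ := hi
      have e1 := hfwd y hy i i' hgg
      have e2 := h2 i i' hgg
      have e3 := hu y hy
      generalize x.coord i = a at *
      generalize x.coord i' = b at *
      generalize y.coord i = c at *
      generalize y.coord i' = d at *
      generalize σ i = p at *
      generalize σ i' = q at *
      clear hu
      subst e3
      revert a b c p q u; decide
    · have hi' : ¬ ∃ y ∈ A.carrier, y.coord i' ≠ 0 := by
        rintro ⟨y, hy, hyi⟩
        refine hi ⟨y, hy, fun h => hyi ?_⟩
        rw [hu y hy, h, mul_zero]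
      rw [h1 i (dif_neg hi), h1 i' (dif_neg hi'), mul_zero]

end MRSubalgebra

/-! ### Coatoms -/

namespace MRSubalgebra

variable {n : ℕ} {A : MRSubalgebra n} {J : Type} {g : Fin n → Option J} {σ : Fin n → SignTypeˣ}

open Classical in
/-- The sign vector supported on the block `j` and equal there to `σ`, multiplied by `s`. -/
noncomputable def blockFace (g : Fin n → Option J) (σ : Fin n → SignTypeˣ) (j : J)
    (s : SignTypeˣ) : CubeFace n :=
  ofCoord fun i => if g i = some j then (σ i : SignType) * s else 0

theorem coord_blockFace_of_eq {i : Fin n} {j : J} (hi : g i = some j) (s : SignTypeˣ) :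
    (blockFace g σ j s).coord i = σ i * s := by
  simp [blockFace, hi]

theorem coord_blockFace_of_ne {i : Fin n} {j : J} (hi : g i ≠ some j) (s : SignTypeˣ) :
    (blockFace g σ j s).coord i = 0 := by
  simp [blockFace, hi]

theorem coord_blockFace_ne_zero {i : Fin n} {j : J} {s : SignTypeˣ} :
    (blockFace g σ j s).coord i ≠ 0 ↔ g i = some j := by
  by_cases hi : g i = some j
  · simp [coord_blockFace_of_eq hi, hi]
  · simp [coord_blockFace_of_ne hi, hi]

namespace IsBlockDecomposition

variable (h : A.IsBlockDecomposition g σ)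
include h

theorem blockFace_mem (j : J) (s : SignTypeˣ) : blockFace g σ j s ∈ A.carrier := by
  refine (h.mem_iff _).2 ⟨fun i hi => coord_blockFace_of_ne (by simp [hi]) s, fun i i' hii => ?_⟩
  by_cases hi : g i = some j
  · rw [coord_blockFace_of_eq hi, coord_blockFace_of_eq (hii ▸ hi), ← mul_assoc, ← mul_assoc,
      SignType.unit_mul_self, SignType.unit_mul_self]
  · rw [coord_blockFace_of_ne hi, coord_blockFace_of_ne (hii ▸ hi), mul_zero, mul_zero]

theorem blockFace_ne_top (j : J) (s : SignTypeˣ) : blockFace g σ j s ≠ ⊤ := by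
  obtain ⟨i, hi⟩ := h.exists_eq_some j
  exact ne_top_iff.2 ⟨i, coord_blockFace_ne_zero.2 hi⟩

theorem coord_eq_of_mem {x : CubeFace n} (hx : x ∈ A.carrier) {i i' : Fin n} (hii : g i = g i') :
    x.coord i' = σ i' * (σ i * x.coord i) := by
  rw [((h.mem_iff x).1 hx).2 i i' hii, ← mul_assoc, SignType.unit_mul_self, one_mul]

theorem exists_le_blockFace {x : CubeFace n} (hx : x ∈ A.carrier) (hxt : x ≠ ⊤) :
    ∃ j s, x ≤ blockFace g σ j s := by
  obtain ⟨i, hi⟩ := ne_top_iff.1 hxt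
  obtain ⟨j, hj⟩ := Option.ne_none_iff_exists'.1 fun h0 => hi (((h.mem_iff x).1 hx).1 i h0)
  refine ⟨j, σ i * Units.mk0 _ hi, le_iff_coord.2 fun i' hi' => ?_⟩
  have hi' := coord_blockFace_ne_zero.1 hi'
  rw [coord_blockFace_of_eq hi', h.coord_eq_of_mem hx (hj.trans hi'.symm)]
  simp

theorem mem_coatoms_iff {a : CubeFace n} : a ∈ A.coatoms ↔ ∃ j s, a = blockFace g σ j s := by
  constructor
  · rintro ⟨ha, hat, hmax⟩
    obtain ⟨j, s, hle⟩ := h.exists_le_blockFace ha hat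
    refine ⟨j, s, hle.eq_or_lt.resolve_right fun hlt => ?_⟩
    exact h.blockFace_ne_top j s (hmax _ (h.blockFace_mem j s) hlt)
  · rintro ⟨j, s, rfl⟩
    refine ⟨h.blockFace_mem j s, h.blockFace_ne_top j s, fun b hb hlt => ?_⟩
    by_contra hbt
    obtain ⟨i, hi⟩ := ne_top_iff.1 hbt
    have hab := le_iff_coord.1 hlt.le i hi
    have hgi : g i = some j := coord_blockFace_ne_zero.1 (hab ▸ hi)
    refine hlt.not_ge (le_iff_coord.2 fun i' hi' => ?_)
    have hii : g i = g i' := hgi.trans (coord_blockFace_ne_zero.1 hi').symm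
    rw [h.coord_eq_of_mem hb hii, h.coord_eq_of_mem (h.blockFace_mem j s) hii, hab]

theorem blockFace_injective :
    Function.Injective fun p : J × SignTypeˣ => blockFace g σ p.1 p.2 := by
  rintro ⟨j, s⟩ ⟨j', s'⟩ hp
  obtain ⟨i, hi⟩ := h.exists_eq_some j
  have hp : blockFace g σ j s = blockFace g σ j' s' := hp
  have hi' : g i = some j' :=
    coord_blockFace_ne_zero.1 (hp ▸ coord_blockFace_ne_zero.2 hi : _ ≠ (0 : SignType))
  obtain rfl : j = j' := Option.some_injective _ (hi.symm.trans hi')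
  have := congrArg (fun x => x.coord i) hp
  simp only [coord_blockFace_of_eq hi, mul_eq_mul_left_iff, Units.ne_zero, or_false] at this
  rw [Units.ext this]

/-- Each block carries two opposite coatoms, which lie below as many facets of the cube as the
block has coordinates. -/
theorem coatomCount_eq (i : ℕ) :
    A.coatomCount i = 2 * {j : J | {c | g c = some j}.ncard = i}.ncard := by
  have hset : {a | a ∈ A.coatoms ∧ (coatomsAbove a).ncard = i} =
      (fun p : J × SignTypeˣ => blockFace g σ p.1 p.2) ''
        ({j : J | {c | g c = some j}.ncard = i} ×ˢ Set.univ) := by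
    ext a
    constructor
    · rintro ⟨ha, hi⟩
      obtain ⟨j, s, rfl⟩ := h.mem_coatoms_iff.1 ha
      refine ⟨(j, s), ⟨?_, trivial⟩, rfl⟩
      simpa only [Set.mem_ofPred_eq, ncard_coatomsAbove, coord_blockFace_ne_zero] using hi
    · rintro ⟨⟨j, s⟩, ⟨hj, -⟩, rfl⟩
      refine ⟨h.mem_coatoms_iff.2 ⟨j, s, rfl⟩, ?_⟩
      simpa only [Set.mem_ofPred_eq, ncard_coatomsAbove, coord_blockFace_ne_zero] using hj
  rw [coatomCount, hset, Set.ncard_image_of_injective _ h.blockFace_injective, Set.ncard_prod,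
    Set.ncard_univ, Nat.card_eq_fintype_card, SignType.card_units, mul_comm]

theorem tp_eq (i : ℕ) : A.tp i = {j : J | {c | g c = some j}.ncard = i}.ncard := by
  rw [tp, h.coatomCount_eq, Nat.mul_div_cancel_left _ two_pos]

end IsBlockDecomposition

end MRSubalgebra

/-! ### Automorphisms as signed permutations -/

namespace CubeAut

variable {n : ℕ}

/-- The automorphism given by a permutation `π` of the coordinates and a choice `ε` of signs:
the coordinate at `i` is multiplied by `ε i` and moved to `π i`. -/
def signedPerm (π : Equiv.Perm (Fin n)) (ε : Fin n → SignTypeˣ) : CubeAut n :=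
  ⟨{  toFun := fun x => ofCoord fun i => ε (π.symm i) * x.coord (π.symm i)
      invFun := fun x => ofCoord fun i => ε i * x.coord (π i)
      left_inv := fun x => coord_ext fun i => by
        simp [← mul_assoc, SignType.unit_mul_self]
      right_inv := fun x => coord_ext fun i => by
        simp [← mul_assoc, SignType.unit_mul_self] },
    by
      refine ⟨fun x y => coord_ext fun i => ?_, fun x y _ => coord_ext fun i => ?_⟩
      · simp only [Equiv.coe_fn_mk, coord_ofCoord, coord_sup]
        generalize x.coord _ = s
        generalize y.coord _ = t
        generalize ε _ = u
        revert s t u; decide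
      · simp only [Equiv.coe_fn_mk, coord_ofCoord, coord_delta]
        generalize x.coord _ = s
        generalize y.coord _ = t
        generalize ε _ = u
        revert s t u; decide⟩

@[simp]
theorem coord_signedPerm (π : Equiv.Perm (Fin n)) (ε : Fin n → SignTypeˣ) (x : CubeFace n)
    (i : Fin n) : ((signedPerm π ε).1 x).coord (π i) = ε i * x.coord i := by
  simp [signedPerm]

theorem apply_top (φ : CubeAut n) : φ.1 ⊤ = ⊤ := by
  apply top_unique
  have := (CubeAut.le_iff φ (φ.1⁻¹ ⊤) ⊤).2 le_top
  simpa using this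

theorem isCoatom_apply (φ : CubeAut n) {c : CubeFace n} (hc : IsCoatom c) : IsCoatom (φ.1 c) := by
  let e : CubeFace n ≃o CubeFace n := ⟨φ.1, fun {a b} => CubeAut.le_iff φ a b⟩
  exact (e.isCoatom_iff c).2 hc

/-- An automorphism permutes the facets of the cube and commutes with the reflection `delta ⊤` of
opposite facets; this is the data of a signed permutation. -/
theorem exists_eq_signedPerm (φ : CubeAut n) : ∃ π ε, signedPerm π ε = φ := by
  have h1 : ∀ i, ∃ i' s, φ.1 (facet i 1) = facet i' s := fun i =>
    isCoatom_iff.1 (isCoatom_apply φ (isCoatom_facet i 1))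
  choose p ε hp using h1
  have hmul : ∀ i s, φ.1 (facet i s) = facet (p i) (ε i * s) := by
    intro i s
    rcases SignType.unit_eq_or_eq_neg 1 s with rfl | rfl
    · rw [hp, mul_one]
    · rw [← delta_top_facet, φ.2.2 _ _ le_top, hp, apply_top, delta_top_facet, mul_neg, mul_one]
  have hinj : Function.Injective p := by
    intro i i' hii
    have h2 : φ.1 (facet i (ε i)) = φ.1 (facet i' (ε i')) := by
      rw [hmul, hmul, hii]
      congr 1
      generalize ε i = u
      generalize ε i' = v
      revert u v; decide
    exact (facet_inj.1 (φ.1.injective h2)).1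
  let π : Equiv.Perm (Fin n) := Equiv.ofBijective p (Finite.injective_iff_bijective.1 hinj)
  refine ⟨π, ε, Subtype.ext (Equiv.ext fun x => coord_ext fun i => ?_)⟩
  obtain ⟨i, rfl⟩ := π.surjective i
  rw [coord_signedPerm]
  have key : ∀ s : SignTypeˣ, x.coord i = s ↔ (φ.1 x).coord (π i) = ε i * s := fun s => by
    rw [← le_facet_iff, ← CubeAut.le_iff φ, hmul, le_facet_iff, Units.val_mul]
    rfl
  generalize (φ.1 x).coord (π i) = a at *
  generalize x.coord i = b at *
  generalize ε i = u at *
  revert a b u; decide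

theorem signedPerm_inj {π π' : Equiv.Perm (Fin n)} {ε ε' : Fin n → SignTypeˣ} :
    signedPerm π ε = signedPerm π' ε' ↔ π = π' ∧ ε = ε' := by
  refine ⟨fun h => ?_, fun h => by rw [h.1, h.2]⟩
  have h1 : ∀ i, π i = π' i ∧ ε i = ε' i := by
    intro i
    have e : ∀ (π : Equiv.Perm (Fin n)) (ε : Fin n → SignTypeˣ),
        (signedPerm π ε).1 (facet i 1) = facet (π i) (ε i) := by
      intro π ε
      refine coord_ext fun k => ?_
      obtain ⟨k, rfl⟩ := π.surjective k
      rw [coord_signedPerm]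
      rcases eq_or_ne k i with rfl | hk
      · simp [facet]
      · simp [facet, hk]
    rw [← facet_inj, ← e, ← e, h]
  exact ⟨Equiv.ext fun i => (h1 i).1, funext fun i => (h1 i).2⟩

theorem signedPerm_bijective :
    Function.Bijective fun p : Equiv.Perm (Fin n) × (Fin n → SignTypeˣ) => signedPerm p.1 p.2 :=
  ⟨fun _ _ h => Prod.ext_iff.2 (signedPerm_inj.1 h), fun φ => by
    obtain ⟨π, ε, h⟩ := exists_eq_signedPerm φ
    exact ⟨(π, ε), h⟩⟩

theorem card_cubeAut (n : ℕ) : Nat.card (CubeAut n) = n.factorial * 2 ^ n := by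
  rw [← Nat.card_congr (Equiv.ofBijective _ (signedPerm_bijective (n := n)))]
  simp [Nat.card_eq_fintype_card, Fintype.card_perm, SignType.card_units]

end CubeAut

/-! ### The stabilizer -/

namespace MRSubalgebra.IsBlockDecomposition

variable {n : ℕ} {A : MRSubalgebra n} {J : Type} {g : Fin n → Option J} {σ : Fin n → SignTypeˣ}
  (h : A.IsBlockDecomposition g σ)
include h

theorem eq_none_iff (i : Fin n) : g i = none ↔ ∀ x ∈ A.carrier, x.coord i = 0 := by
  refine ⟨fun hi x hx => ((h.mem_iff x).1 hx).1 i hi, fun hi => ?_⟩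
  by_contra h0
  obtain ⟨j, hj⟩ := Option.ne_none_iff_exists'.1 h0
  exact coord_blockFace_ne_zero.2 hj (hi _ (h.blockFace_mem j 1))

theorem eq_iff (i i' : Fin n) :
    g i = g i' ↔ ∀ x ∈ A.carrier, x.coord i = 0 ↔ x.coord i' = 0 := by
  refine ⟨fun hii x hx => ?_, fun hx => ?_⟩
  · rw [h.coord_eq_of_mem hx hii]
    simp
  · cases hi : g i with
    | none =>
      rw [eq_comm, h.eq_none_iff]
      exact fun x hxA => (hx x hxA).1 ((h.eq_none_iff i).1 hi x hxA)
    | some j =>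
      have := (hx _ (h.blockFace_mem j 1)).not.1 (coord_blockFace_ne_zero.2 hi)
      exact (coord_blockFace_ne_zero.1 this).symm

/-- The signed permutations that stabilize `A` are those which permute the blocks and whose signs,
measured against `σ`, are constant on each block. -/
theorem signedPerm_mem_stabilizer_iff (π : Equiv.Perm (Fin n)) (ε : Fin n → SignTypeˣ) :
    CubeAut.signedPerm π ε ∈ MulAction.stabilizer (CubeAut n) A ↔
      (∃ τ : Equiv.Perm J, ∀ i, g (π i) = (g i).map τ) ∧
      ∀ i i', g i = g i' → g i ≠ none → σ (π i) * ε i * σ i = σ (π i') * ε i' * σ i' := by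
  classical
  rw [MulAction.mem_stabilizer_iff]
  set φ := CubeAut.signedPerm π ε with hφ
  constructor
  · intro hA
    have hA' : φ.1 '' A.carrier = A.carrier := congrArg carrier hA
    have hmem : ∀ x ∈ A.carrier, φ.1 x ∈ A.carrier := fun x hx =>
      hA' ▸ Set.mem_image_of_mem _ hx
    have hsurj : ∀ x ∈ A.carrier, ∃ y ∈ A.carrier, φ.1 y = x := fun x hx => by
      rwa [← hA'] at hx
    have hnone : ∀ i, g (π i) = none ↔ g i = none := by
      intro i
      rw [h.eq_none_iff, h.eq_none_iff]
      constructor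
      · intro H x hx
        simpa [hφ] using H _ (hmem x hx)
      · intro H x hx
        obtain ⟨y, hy, rfl⟩ := hsurj x hx
        simp [hφ, H y hy]
    have heq : ∀ i i', g (π i) = g (π i') ↔ g i = g i' := by
      intro i i'
      rw [h.eq_iff, h.eq_iff]
      constructor
      · intro H x hx
        simpa [hφ] using H _ (hmem x hx)
      · intro H x hx
        obtain ⟨y, hy, rfl⟩ := hsurj x hx
        simpa [hφ] using H y hy
    refine ⟨?_, fun i i' hii hi => ?_⟩
    · have hτ : ∀ j, ∃ j', ∀ i, g i = some j → g (π i) = some j' := by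
        intro j
        obtain ⟨i, hi⟩ := h.exists_eq_some j
        obtain ⟨j', hj'⟩ := Option.ne_none_iff_exists'.1
          (fun h0 => by simp [(hnone i).1 h0] at hi : g (π i) ≠ none)
        exact ⟨j', fun i' hi' => hj' ▸ (heq i' i).2 (hi'.trans hi.symm)⟩
      choose τ hτ using hτ
      have hinj : Function.Injective τ := by
        intro j j' hjj
        obtain ⟨i, hi⟩ := h.exists_eq_some j
        obtain ⟨i', hi'⟩ := h.exists_eq_some j'
        have : g i = g i' := by rw [← heq, hτ j i hi, hτ j' i' hi', hjj]
        exact Option.some_injective _ (by rw [← hi, ← hi', this])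
      have : Finite J := Finite.of_surjective (fun i : {i // g i ≠ none} =>
        (g i).get (Option.isSome_iff_ne_none.2 i.2)) fun j => by
          obtain ⟨i, hi⟩ := h.exists_eq_some j
          exact ⟨⟨i, by simp [hi]⟩, by simp [hi]⟩
      refine ⟨Equiv.ofBijective τ (Finite.injective_iff_bijective.1 hinj), fun i => ?_⟩
      cases hi : g i with
      | none => simpa using (hnone i).2 hi
      | some j => simpa using hτ j i hi
    · obtain ⟨j, hj⟩ := Option.ne_none_iff_exists'.1 hi
      have h1 := ((h.mem_iff _).1 (hmem _ (h.blockFace_mem j 1))).2 (π i) (π i')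
        ((heq i i').2 hii)
      rw [hφ, CubeAut.coord_signedPerm, CubeAut.coord_signedPerm, coord_blockFace_of_eq hj,
        coord_blockFace_of_eq (hii ▸ hj)] at h1
      apply Units.ext
      simpa [mul_assoc] using h1
  · rintro ⟨⟨τ, hτ⟩, hσ⟩
    have hsub : φ.1 '' A.carrier ⊆ A.carrier := by
      rintro _ ⟨x, hx, rfl⟩
      refine (h.mem_iff _).2 ⟨fun i hi => ?_, fun i i' hii => ?_⟩
      · obtain ⟨i, rfl⟩ := π.surjective i
        rw [hτ, Option.map_eq_none_iff] at hi
        rw [hφ, CubeAut.coord_signedPerm, ((h.mem_iff x).1 hx).1 i hi, mul_zero]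
      · obtain ⟨i, rfl⟩ := π.surjective i
        obtain ⟨i', rfl⟩ := π.surjective i'
        rw [hτ, hτ] at hii
        replace hii := Option.map_injective τ.injective hii
        rw [hφ, CubeAut.coord_signedPerm, CubeAut.coord_signedPerm]
        by_cases hi : g i = none
        · rw [((h.mem_iff x).1 hx).1 i hi, ((h.mem_iff x).1 hx).1 i' (hii ▸ hi)]
          simp
        · have h1 := hσ i i' hii hi
          rw [h.coord_eq_of_mem hx hii]
          have h2 := congrArg (Units.val) h1
          simp only [Units.val_mul] at h2
          calc (σ (π i) : SignType) * (ε i * x.coord i)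
              = σ (π i) * ε i * (σ i * σ i) * x.coord i := by
                rw [SignType.unit_mul_self, mul_one, mul_assoc]
            _ = σ (π i) * ε i * σ i * (σ i * x.coord i) := by simp only [mul_assoc]
            _ = σ (π i') * ε i' * σ i' * (σ i * x.coord i) := by rw [h2]
            _ = _ := by simp only [mul_assoc]
    have := finite_cubeFace n
    refine MRSubalgebra.ext (Set.eq_of_subset_of_ncard_le hsub ?_ (Set.toFinite _))
    exact (Set.ncard_image_of_injective A.carrier φ.1.injective).ge

end MRSubalgebra.IsBlockDecomposition

/-! ### Counting -/

/-- The permutations that cover a given permutation `τ` of the fibres of `g` form a coset of the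
group of permutations preserving each fibre. -/
theorem card_perm_semiconj {α β : Type*} [Finite α] [Fintype β] (g : α → β) (τ : Equiv.Perm β)
    (hτ : ∀ b, {a | g a = τ b}.ncard = {a | g a = b}.ncard) :
    Nat.card {π : Equiv.Perm α // ∀ a, g (π a) = τ (g a)} =
      ∏ b, ({a | g a = b}.ncard).factorial := by
  have e : ∀ b, Nonempty ({a // τ (g a) = b} ≃ {a // g a = b}) := by
    intro b
    obtain ⟨b, rfl⟩ := τ.surjective b
    refine Finite.card_eq.1 ?_
    have := hτ b
    simp only [τ.injective.eq_iff]
    exact this.symm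
  let π₀ : Equiv.Perm α := Equiv.ofFiberEquiv (f := τ ∘ g) (g := g) fun b => (e b).some
  have hπ₀ : ∀ a, g (π₀ a) = τ (g a) := Equiv.ofFiberEquiv_map _
  have h1 : Nat.card {ρ : Equiv.Perm α // g ∘ ρ = g} =
      Nat.card {π : Equiv.Perm α // ∀ a, g (π a) = τ (g a)} := by
    refine Nat.card_congr ((Equiv.mulLeft π₀).subtypeEquiv fun ρ => ?_)
    simp [funext_iff, hπ₀]
  rw [← h1]
  exact DomMulAct.stabilizer_ncard g

namespace MRSubalgebra.IsBlockDecomposition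

variable {n : ℕ} {A : MRSubalgebra n} {J : Type} {g : Fin n → Option J} {σ : Fin n → SignTypeˣ}
  (h : A.IsBlockDecomposition g σ)
include h

theorem block_ncard_mem_Icc (j : J) : {c | g c = some j}.ncard ∈ Finset.Icc 1 n := by
  rw [Finset.mem_Icc]
  constructor
  · obtain ⟨i, hi⟩ := h.exists_eq_some j
    exact (Set.ncard_pos (Set.toFinite _)).2 ⟨i, hi⟩
  · simpa using Set.ncard_le_card {c | g c = some j}

variable [Fintype J]

@[to_additive]
theorem prod_blocks {M : Type*} [CommMonoid M] (f : ℕ → M) :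
    ∏ j, f {c | g c = some j}.ncard = ∏ i ∈ Finset.Icc 1 n, f i ^ A.tp i := by
  classical
  rw [← Finset.prod_fiberwise_of_maps_to' (fun j _ => h.block_ncard_mem_Icc j)]
  refine Finset.prod_congr rfl fun i _ => ?_
  rw [Finset.prod_const, h.tp_eq, Set.ncard_eq_toFinset_card']
  congr 2
  ext; simp

omit h in
theorem ncard_none_add_sum_blocks :
    {i | g i = none}.ncard + ∑ j, {c | g c = some j}.ncard = n := by
  rw [← Fintype.sum_option fun b => {i | g i = b}.ncard]
  have := Nat.card_congr (Equiv.sigmaFiberEquiv g)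
  rw [Nat.card_sigma, Nat.card_fin] at this
  exact this

theorem card_perm_size_preserving :
    Nat.card {τ : Equiv.Perm J // ∀ j, {c | g c = some (τ j)}.ncard = {c | g c = some j}.ncard} =
      ∏ i ∈ Finset.Icc 1 n, (A.tp i).factorial := by
  let s : J → Finset.Icc 1 n := fun j => ⟨{c | g c = some j}.ncard, h.block_ncard_mem_Icc j⟩
  have h1 := DomMulAct.stabilizer_ncard s
  rw [← Finset.prod_coe_sort]
  convert h1 using 3 with i
  · refine Nat.card_congr (Equiv.subtypeEquivRight fun τ => ?_)
    simp [funext_iff, s]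
  · rw [h.tp_eq]
    simp [s, Subtype.ext_iff]

/-- A permutation of the coordinates that permutes the blocks induces a size-preserving permutation
of the set of blocks, and the permutations inducing a given one form a coset of the group
preserving every block. -/
theorem card_block_perm :
    Nat.card {π : Equiv.Perm (Fin n) // ∃ τ : Equiv.Perm J, ∀ i, g (π i) = (g i).map τ} =
      ({i | g i = none}.ncard).factorial *
        ∏ i ∈ Finset.Icc 1 n, (i.factorial ^ A.tp i * (A.tp i).factorial) := by
  classical
  -- A permutation `π` covering `τ` maps the block `j` onto the block `τ j`.
  have hsize : ∀ (π : Equiv.Perm (Fin n)) (τ : Equiv.Perm J), (∀ i, g (π i) = (g i).map τ) →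
      ∀ j, {c | g c = some (τ j)}.ncard = {c | g c = some j}.ncard := by
    intro π τ hτ j
    rw [← Set.ncard_image_of_injective {c | g c = some j} π.injective]
    congr 1
    ext c
    obtain ⟨c, rfl⟩ := π.surjective c
    simp [hτ]
  -- The induced permutation `τ` is determined by `π`, since all blocks are nonempty.
  let T := {τ : Equiv.Perm J // ∀ j, {c | g c = some (τ j)}.ncard = {c | g c = some j}.ncard}
  let F : (Σ τ : T, {π : Equiv.Perm (Fin n) // ∀ i, g (π i) = Equiv.optionCongr τ.1 (g i)}) →
      {π : Equiv.Perm (Fin n) // ∃ τ : Equiv.Perm J, ∀ i, g (π i) = (g i).map τ} :=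
    fun p => ⟨p.2.1, p.1.1, p.2.2⟩
  have hF : Function.Bijective F := by
    constructor
    · rintro ⟨⟨τ, hτ⟩, π, hπ⟩ ⟨⟨τ', hτ'⟩, π', hπ'⟩ hpp
      obtain rfl : π = π' := congrArg Subtype.val hpp
      obtain rfl : τ = τ' := by
        ext j
        obtain ⟨i, hi⟩ := h.exists_eq_some j
        have := (hπ i).symm.trans (hπ' i)
        simpa [hi] using this
      rfl
    · rintro ⟨π, τ, hτ⟩
      exact ⟨⟨⟨τ, hsize π τ hτ⟩, π, hτ⟩, rfl⟩
  have hfib : ∀ τ : T,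
      Nat.card {π : Equiv.Perm (Fin n) // ∀ i, g (π i) = Equiv.optionCongr τ.1 (g i)} =
        ({i | g i = none}.ncard).factorial * ∏ i ∈ Finset.Icc 1 n, i.factorial ^ A.tp i := by
    intro τ
    rw [card_perm_semiconj, Fintype.prod_option, h.prod_blocks fun i => i.factorial]
    rintro (_ | j)
    · rfl
    · exact τ.2 j
  rw [← Nat.card_congr (Equiv.ofBijective F hF), Nat.card_sigma, Finset.sum_congr rfl
    fun τ _ => hfib τ, Finset.sum_const, Finset.card_univ, ← Nat.card_eq_fintype_card,
    h.card_perm_size_preserving, smul_eq_mul, Finset.prod_mul_distrib]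
  ring

omit [Fintype J] in
/-- Given a permutation `π` of the blocks, the signs `ε` for which `signedPerm π ε` stabilizes `A`
are free on the coordinates outside the blocks, and given by one sign for each block. -/
theorem card_stabilizer_eq_mul [Finite J] :
    Nat.card (MulAction.stabilizer (CubeAut n) A) =
      Nat.card {π : Equiv.Perm (Fin n) // ∃ τ : Equiv.Perm J, ∀ i, g (π i) = (g i).map τ} *
        2 ^ (Nat.card J + {i | g i = none}.ncard) := by
  classical
  -- `q` identifies the coordinates of each block and keeps apart those outside the blocks.
  let q : Fin n → J ⊕ {i // g i = none} := fun i =>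
    if hi : g i = none then Sum.inr ⟨i, hi⟩
    else Sum.inl ((g i).get (Option.isSome_iff_ne_none.2 hi))
  have hq_some : ∀ i j, g i = some j → q i = Sum.inl j := fun i j hi => by simp [q, hi]
  have hq_none : ∀ i (hi : g i = none), q i = Sum.inr ⟨i, hi⟩ := fun i hi => by simp [q, hi]
  have hq : Function.Surjective q := by
    rintro (j | ⟨i, hi⟩)
    · obtain ⟨i, hi⟩ := h.exists_eq_some j
      exact ⟨i, hq_some i j hi⟩
    · exact ⟨i, hq_none i hi⟩
  have hq_eq : ∀ i i', q i = q i' → i = i' ∨ g i = g i' ∧ g i ≠ none := by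
    intro i i' hii
    cases hi : g i with
    | none =>
      cases hi' : g i' with
      | none =>
        rw [hq_none i hi, hq_none i' hi'] at hii
        simp only [Sum.inr.injEq, Subtype.mk.injEq] at hii
        exact Or.inl hii
      | some j' =>
        rw [hq_none i hi, hq_some i' j' hi'] at hii
        cases hii
    | some j =>
      cases hi' : g i' with
      | none =>
        rw [hq_some i j hi, hq_none i' hi'] at hii
        cases hii
      | some j' =>
        rw [hq_some i j hi, hq_some i' j' hi'] at hii
        simp only [Sum.inl.injEq] at hii
        simp [hii]
  let P := {π : Equiv.Perm (Fin n) // ∃ τ : Equiv.Perm J, ∀ i, g (π i) = (g i).map τ}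
  have hcancel : ∀ u v w : SignTypeˣ, u * (u * v * w) * w = v := by decide
  -- The sign of `signedPerm` measured against `σ` is prescribed to be a function of `q i`.
  let F : P × (J ⊕ {i // g i = none} → SignTypeˣ) → MulAction.stabilizer (CubeAut n) A :=
    fun p => ⟨CubeAut.signedPerm p.1.1 fun i => σ (p.1.1 i) * p.2 (q i) * σ i,
      (h.signedPerm_mem_stabilizer_iff _ _).2 ⟨p.1.2, fun i i' hii hi => by
        obtain ⟨j, hj⟩ := Option.ne_none_iff_exists'.1 hi
        rw [hcancel, hcancel, hq_some i j hj, hq_some i' j (hii ▸ hj)]⟩⟩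
  have hFval : ∀ p, (F p).1 =
      CubeAut.signedPerm p.1.1 fun i => σ (p.1.1 i) * p.2 (q i) * σ i := fun _ => rfl
  have hF : Function.Bijective F := by
    constructor
    · rintro ⟨⟨π, hπ⟩, c⟩ ⟨⟨π', hπ'⟩, c'⟩ hpp
      obtain ⟨rfl, h1⟩ := CubeAut.signedPerm_inj.1
        ((hFval _).symm.trans ((congrArg Subtype.val hpp).trans (hFval _)))
      congr 1
      funext k
      obtain ⟨i, rfl⟩ := hq k
      have h2 := congrFun h1 i
      simpa using h2
    · rintro ⟨φ, hφ⟩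
      obtain ⟨π, ε, rfl⟩ := CubeAut.exists_eq_signedPerm φ
      obtain ⟨h1, h2⟩ := (h.signedPerm_mem_stabilizer_iff _ _).1 hφ
      refine ⟨(⟨π, h1⟩, fun k => σ (π (Function.surjInv hq k)) * ε (Function.surjInv hq k) *
        σ (Function.surjInv hq k)), Subtype.ext ?_⟩
      rw [hFval]
      refine CubeAut.signedPerm_inj.2 ⟨rfl, funext fun i => ?_⟩
      have h3 : ∀ i', q i' = q i → σ (π i') * ε i' * σ i' = σ (π i) * ε i * σ i := by
        intro i' hii
        rcases hq_eq i' i hii with rfl | ⟨h4, h5⟩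
        · rfl
        · exact h2 i' i h4 h5
      dsimp only
      rw [h3 _ (Function.surjInv_eq hq (q i)), hcancel]
  have hcardN : Nat.card {i // g i = none} = {i | g i = none}.ncard := rfl
  rw [← Nat.card_congr (Equiv.ofBijective F hF), Nat.card_prod, Nat.card_fun, Nat.card_sum,
    Nat.card_eq_fintype_card (α := SignTypeˣ), SignType.card_units, hcardN]

end MRSubalgebra.IsBlockDecomposition

/-! ### Orbit and stabilizer -/

theorem mainTheorem2 (n : ℕ) (A : MRSubalgebra n) (t : ℕ → ℕ) (ht : ∀ i, t i = A.tp i) (r k : ℕ)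
    (hr : r = ∑ i ∈ Finset.Icc 1 n, i * t i) (hk : k = ∑ i ∈ Finset.Icc 1 n, t i) :
    (∀ i, A.coatomCount i = 2 * t i) ∧ k ≤ r ∧ r ≤ n ∧
    (Nat.card (MulAction.orbit (CubeAut n) A) : ℚ) =
      2 ^ (r - k) * (n.choose r : ℚ) * (r.factorial : ℚ) /
        ∏ i ∈ Finset.Icc 1 n, ((i.factorial : ℚ) ^ t i * ((t i).factorial : ℚ)) ∧
    Nat.card (MulAction.stabilizer (CubeAut n) A) =
      2 ^ (n + k - r) * (n - r).factorial *
        ∏ i ∈ Finset.Icc 1 n, (i.factorial ^ t i * (t i).factorial) := by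
  obtain rfl : t = A.tp := funext ht
  obtain ⟨J, _, g, σ, h⟩ := A.exists_isBlockDecomposition
  have hk' : k = Nat.card J := by
    have := h.sum_blocks fun _ => 1
    simp only [Finset.sum_const, Finset.card_univ, smul_eq_mul, mul_one] at this
    rw [hk, ← this, Nat.card_eq_fintype_card]
  have hr' : r = ∑ j, {c | g c = some j}.ncard := by
    have := h.sum_blocks fun i => i
    simp only [smul_eq_mul, mul_comm (A.tp _)] at this
    rw [hr, this]
  have hn := MRSubalgebra.IsBlockDecomposition.ncard_none_add_sum_blocks (g := g)
  rw [← hr'] at hn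
  have hkr : k ≤ r := by
    rw [hk, hr]
    refine Finset.sum_le_sum fun i hi => Nat.le_mul_of_pos_left _ (Finset.mem_Icc.1 hi).1
  have hrn : r ≤ n := by omega
  have hstab : Nat.card (MulAction.stabilizer (CubeAut n) A) =
      2 ^ (n + k - r) * (n - r).factorial *
        ∏ i ∈ Finset.Icc 1 n, (i.factorial ^ A.tp i * (A.tp i).factorial) := by
    rw [h.card_stabilizer_eq_mul, h.card_block_perm, ← hk',
      show {i | g i = none}.ncard = n - r by omega, show n + k - r = k + (n - r) by omega]
    ring
  refine ⟨fun i => by rw [h.coatomCount_eq, h.tp_eq], hkr, hrn, ?_, hstab⟩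
  have horb : Nat.card (MulAction.orbit (CubeAut n) A) *
      Nat.card (MulAction.stabilizer (CubeAut n) A) = n.factorial * 2 ^ n := by
    rw [← CubeAut.card_cubeAut, ← Nat.card_prod,
      Nat.card_congr (MulAction.orbitProdStabilizerEquivGroup (CubeAut n) A)]
  set p := ∏ i ∈ Finset.Icc 1 n, (i.factorial ^ A.tp i * (A.tp i).factorial) with hp
  have hp0 : p ≠ 0 := Finset.prod_ne_zero_iff.2 fun i _ => by positivity
  have hpq : ∏ i ∈ Finset.Icc 1 n, ((i.factorial : ℚ) ^ A.tp i * ((A.tp i).factorial : ℚ)) = p := by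
    rw [hp]; push_cast; rfl
  rw [hpq, eq_div_iff (by exact_mod_cast hp0)]
  norm_cast
  have hpos : 0 < 2 ^ (n + k - r) * (n - r).factorial := by positivity
  refine Nat.eq_of_mul_eq_mul_right hpos ?_
  calc _ = Nat.card (MulAction.orbit (CubeAut n) A) *
        (2 ^ (n + k - r) * (n - r).factorial * p) := by ring
    _ = n.choose r * r.factorial * (n - r).factorial * 2 ^ (r - k + (n + k - r)) := by
      rw [← hstab, horb, Nat.choose_mul_factorial_mul_factorial hrn]
      congr 2
      omega
    _ = _ := by rw [pow_add]; ring
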